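/- **Theorem 1.6.** Let $n\ge 2$ and $k\ge \ell\ge \ell'\ge t\ge 1$ be integers. Let $[m]=\{1,\dots,m\}=\bigcup_{i=1}^{k}X_i$, where $X_1,\dots,X_k$ are pairwise disjoint sets with $|X_i|=n$ (so $m=nk$), and let $v_i$ be the smallest element of $X_i$. For $1\le s\le k$ put $$\mathcal H(n,k,s)=\{H\subseteq[m] : |H|=s,\ |H\cap X_i|\le 1 \text{ for all } 1\le i\le k\}.$$ Define $$\mathcal F_0=\{F\in\mathcal H(n,k,\ell) : |F\cap\{v_1,\dots,v_{\ell'}\}|\ge t\},\qquad \mathcal G_0=\{\{v_1,\dots,v_{\ell'}\}\},$$ and, for $1\le a\le k$, $$\mathcal F_a=\{F\in\mathcal H(n,k,\ell) : \{v_1,\dots,v_a\}\subseteq F\},\qquad \mathcal G_a=\{G\in\mathcal H(n,k,\ell') : |G\cap\{v_1,\dots,v_a\}|\ge t\}.$$ Let $\mathcal F\subseteq\mathcal H(n,k,\ell)$ and $\mathcal G\subseteq\mathcal H(n,k,\ell')$ be non-empty families that are cross $t$-intersecting, that is, $|F\cap G|\ge t$ for all $F\in\mathcal F$ and $G\in\mathcal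 G$. Then $$|\mathcal F|+|\mathcal G|\le\max\Bigl\{|\mathcal F_0|+|\mathcal G_0|,\ \max_{\ell'+1\le a\le \ell}\bigl(|\mathcal F_a|+|\mathcal G_a|\bigr)\Bigr\},$$ where the inner maximum is omitted if $\ell=\ell'$. -/

import Mathlib

/-- `sepH X ℓ` is the family `H(n,k,ℓ)` for the blocks `X 0, …, X (k-1)` (the paper's
`X_1, …, X_k`): all `ℓ`-element subsets of the ground set `Fin m` that meet every block in
at most one element. -/
def sepH {m k : ℕ} (X : Fin k → Finset (Fin m)) (ℓ : ℕ) : Finset (Finset (Fin m)) :=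
  (Finset.powersetCard ℓ Finset.univ).filter (fun H => ∀ i, (H ∩ X i).card ≤ 1)

/-- Every member of `F` meets every member of `G` in at least `t` elements. -/
def CrossTIntersecting {m : ℕ} (t : ℕ) (F G : Finset (Finset (Fin m))) : Prop :=
  ∀ A ∈ F, ∀ B ∈ G, t ≤ (A ∩ B).card

/-- The set `{v_1, …, v_a}` (indices shifted to start at `0`); used only for `a ≤ k`. -/
def firstV {m k : ℕ} (v : Fin k → Fin m) (a : ℕ) : Finset (Fin m) :=
  (Finset.univ.filter (fun i : Fin k => (i : ℕ) < a)).image v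

/-- The members of `H(n,k,ℓ)` that contain at least `t` of the elements `v_1, …, v_a`. -/
def atLeastT {m k : ℕ} (X : Fin k → Finset (Fin m)) (v : Fin k → Fin m) (ℓ t a : ℕ) :
    Finset (Finset (Fin m)) :=
  (sepH X ℓ).filter (fun H => t ≤ (H ∩ firstV v a).card)

/-- The members of `H(n,k,ℓ)` that contain all of `v_1, …, v_a`. -/
def containingV {m k : ℕ} (X : Fin k → Finset (Fin m)) (v : Fin k → Fin m) (ℓ a : ℕ) :
    Finset (Finset (Fin m)) :=
  (sepH X ℓ).filter (fun H => firstV v a ⊆ H)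

/-- `F_0 = {F ∈ H(n,k,ℓ) : |F ∩ {v_1, …, v_ℓ'}| ≥ t}`. -/
def famF0 {m k : ℕ} (X : Fin k → Finset (Fin m)) (v : Fin k → Fin m) (ℓ ℓ' t : ℕ) :
    Finset (Finset (Fin m)) :=
  atLeastT X v ℓ t ℓ'

/-- `G_0 = {{v_1, …, v_ℓ'}}`. -/
def famG0 {m k : ℕ} (v : Fin k → Fin m) (ℓ' : ℕ) : Finset (Finset (Fin m)) :=
  {firstV v ℓ'}

/-- `F_a = {F ∈ H(n,k,ℓ) : {v_1, …, v_a} ⊆ F}`. -/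
def famF {m k : ℕ} (X : Fin k → Finset (Fin m)) (v : Fin k → Fin m) (ℓ a : ℕ) :
    Finset (Finset (Fin m)) :=
  containingV X v ℓ a

/-- `G_a = {G ∈ H(n,k,ℓ') : |G ∩ {v_1, …, v_a}| ≥ t}`. -/
def famG {m k : ℕ} (X : Fin k → Finset (Fin m)) (v : Fin k → Fin m) (ℓ' t a : ℕ) :
    Finset (Finset (Fin m)) :=
  atLeastT X v ℓ' t a

/-!
The bound follows from an uncrossing argument for cross `t`-intersecting pairs. If `(A, B)` and
`(A', B')` are such pairs, so are `(A ∩ A', B ∪ B')` and `(A ∪ A', B ∩ B')` (as long as they consist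
of non-empty families), and the four sizes add up to `|A| + |B| + |A'| + |B'|`. Choose a pair
`(A, B)` that maximizes `|A| + |B|` and, among those, minimizes the size of its smaller family, say
`A`. Uncrossing shows that a pair `(A', B')` with `|A'| = |A|`, `|B'| = |B|` and `A ∩ A' ≠ ∅` has
`A' = A` (`IsAtomPair.eq_of_inter_nonempty`). This applies to the images of `(A, B)` under the
permutations of the ground set that respect the blocks, so that `A` behaves like a block of
imprimitivity, and to the images of `(A, B)` under the shifts that replace `x` by `y` in the same
block.

It follows that `|A| = 1` (`IsAtomPair.card_eq_one`). Suppose that `H ≠ K` are in `A`, and take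
`x ∈ K \ H` and `y ≠ x` in the block of `x`. The shift `x → y` fixes `H`, so it maps `A` to itself,
and `(K \ {x}) ∪ {y}` is in `A`. By transitivity of the block-respecting permutations on separated
sets with a marked element, every element of every member of `A` can be exchanged within its block
without leaving `A`. Exchanging the elements that a member of `A` shares with a fixed member `G` of
`B` produces a member of `A` disjoint from `G`, which contradicts `t ≥ 1`.

Thus `|F| + |G|` is at most one plus the number of separated sets that meet a fixed separated set
`K` in at least `t` elements. By transitivity `K` may be taken to be `{v_1, …, v_ℓ'}` or
`{v_1, …, v_ℓ}`; the former gives the first term of the maximum, the latter the term `a = ℓ`, or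
again the first term if `ℓ = ℓ'`.
-/

open scoped Pointwise

/-! ### Separated sets and fibre-preserving permutations -/

section SeparatedSets

variable {α ι : Type*} [DecidableEq α]

/-- `H` is an `s`-element set meeting every fibre of `b` in at most one element. The blocks of the
ground set are encoded as the fibres of the map `b` that sends an element to the index of its
block. -/
def IsSeparated (b : α → ι) (s : ℕ) (H : Finset α) : Prop :=
  H.card = s ∧ Set.InjOn b H

/-- The permutation `σ` maps fibres of `b` to fibres of `b`, possibly permuting the fibres. -/
def PreservesFibres (b : α → ι) (σ : Equiv.Perm α) : Prop :=
  ∀ x y, b (σ x) = b (σ y) ↔ b x = b y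

lemma IsSeparated.smul {b : α → ι} {s : ℕ} {H : Finset α} {σ : Equiv.Perm α}
    (hσ : PreservesFibres b σ) (hH : IsSeparated b s H) : IsSeparated b s (σ • H) := by
  refine ⟨by rw [Finset.card_smul_finset]; exact hH.1, ?_⟩
  intro x hx y hy hxy
  rw [Finset.mem_coe, Finset.mem_smul_finset] at hx hy
  obtain ⟨x, hx, rfl⟩ := hx
  obtain ⟨y, hy, rfl⟩ := hy
  rw [hH.2 hx hy ((hσ x y).1 hxy)]

lemma preservesFibres_swap {b : α → ι} {x y : α} (hxy : b x = b y) :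
    PreservesFibres b (Equiv.swap x y) := by
  have h : ∀ z, b (Equiv.swap x y z) = b z := by
    intro z
    rw [Equiv.swap_apply_def]
    split_ifs <;> simp_all
  intro z w
  rw [h, h]

omit [DecidableEq α] in
lemma PreservesFibres.mul {b : α → ι} {σ τ : Equiv.Perm α} (hσ : PreservesFibres b σ)
    (hτ : PreservesFibres b τ) : PreservesFibres b (σ * τ) := fun x y =>
  (hσ (τ x) (τ y)).trans (hτ x y)

lemma swap_smul_of_mem_of_notMem {x y : α} {H : Finset α} (hx : x ∈ H) (hy : y ∉ H) :
    Equiv.swap x y • H = insert y (H.erase x) := by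
  ext z
  rw [← Finset.inv_smul_mem_iff, Equiv.swap_inv, Equiv.Perm.smul_def,
    Equiv.swap_apply_def]
  split_ifs with h1 h2 <;> simp_all
  rintro rfl; exact hy hx

lemma swap_smul_of_notMem {x y : α} {H : Finset α} (hx : x ∉ H) (hy : y ∉ H) :
    Equiv.swap x y • H = H := by
  ext z
  rw [← Finset.inv_smul_mem_iff, Equiv.swap_inv, Equiv.Perm.smul_def,
    Equiv.swap_apply_def]
  split_ifs with h1 h2 <;> simp_all

omit [DecidableEq α] in
lemma IsSeparated.notMem_of_mem {b : α → ι} {s : ℕ} {H : Finset α} (hH : IsSeparated b s H)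
    {x y : α} (hx : x ∈ H) (hne : y ≠ x) (hxy : b x = b y) : y ∉ H :=
  fun hy => hne (hH.2 hy hx hxy.symm)

/-- Fibre-preserving permutations act transitively on separated sets with a marked element,
provided that all fibres have the same size. -/
lemma exists_preservesFibres_smul_eq [Fintype α] [Fintype ι] [DecidableEq ι] {b : α → ι} {n : ℕ}
    (hb : ∀ i, Fintype.card {x // b x = i} = n) {s : ℕ} {K L : Finset α}
    (hK : IsSeparated b s K) (hL : IsSeparated b s L) {x z : α} (hx : x ∈ K) (hz : z ∈ L) :
    ∃ σ, PreservesFibres b σ ∧ σ • K = L ∧ σ x = z := by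
  classical
  -- a permutation of the index set carrying the support of `K` to that of `L`
  have hcard : Fintype.card {i // i ∈ K.image b} = Fintype.card {i // i ∈ L.image b} := by
    simp only [Fintype.card_coe]
    rw [Finset.card_image_of_injOn hK.2, Finset.card_image_of_injOn hL.2, hK.1, hL.1]
  obtain ⟨τ, hτ, hτx⟩ : ∃ τ : Equiv.Perm ι,
      (∀ i ∈ K.image b, τ i ∈ L.image b) ∧ τ (b x) = b z := by
    let τ₀ := (Fintype.equivOfCardEq hcard).extendSubtype
    have hτ₀ : ∀ i ∈ K.image b, τ₀ i ∈ L.image b := fun i hi =>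
      (Fintype.equivOfCardEq hcard).extendSubtype_mem i hi
    have hxz := hτ₀ (b x) (Finset.mem_image_of_mem b hx)
    refine ⟨Equiv.swap (τ₀ (b x)) (b z) * τ₀, fun i hi => ?_, by simp⟩
    rw [Equiv.Perm.mul_apply, Equiv.swap_apply_def]
    split_ifs
    · exact Finset.mem_image_of_mem b hz
    · exact hxz
    · exact hτ₀ i hi
  -- bijections between corresponding fibres that carry the element of `K`, if any, to that of `L`
  have hfib : ∀ i, ∃ e : {x // b x = i} ≃ {x // b x = τ i},
      ∀ p : {x // b x = i}, (p : α) ∈ K → (e p : α) ∈ L := by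
    intro i
    let e₀ : {x // b x = i} ≃ {x // b x = τ i} := Fintype.equivOfCardEq (by rw [hb, hb])
    by_cases hi : i ∈ K.image b
    · obtain ⟨p, hp, rfl⟩ := Finset.mem_image.1 hi
      obtain ⟨q, hq, hqp⟩ := Finset.mem_image.1 (hτ (b p) hi)
      refine ⟨e₀.trans (Equiv.swap (e₀ ⟨p, rfl⟩) ⟨q, hqp⟩), fun r hr => ?_⟩
      have : r = ⟨p, rfl⟩ := Subtype.ext (hK.2 hr hp r.2)
      subst this
      simpa using hq
    · exact ⟨e₀, fun p hp => absurd (Finset.mem_image.2 ⟨(p : α), hp, p.2⟩ : i ∈ K.image b) hi⟩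
  choose e he using hfib
  let σ : Equiv.Perm α := (Equiv.sigmaFiberEquiv b).symm.trans
    ((Equiv.sigmaCongr τ e).trans (Equiv.sigmaFiberEquiv b))
  have hσ : ∀ y, σ y = (e (b y) ⟨y, rfl⟩ : α) := fun y => rfl
  have hbσ : ∀ y, b (σ y) = τ (b y) := fun y => (hσ y).symm ▸ (e (b y) ⟨y, rfl⟩).2
  have hσK : σ • K = L := by
    refine Finset.eq_of_subset_of_card_le ?_ (by rw [Finset.card_smul_finset, hK.1, hL.1])
    intro y hy
    obtain ⟨p, hp, rfl⟩ := Finset.mem_smul_finset.1 hy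
    exact he (b p) ⟨p, rfl⟩ hp
  refine ⟨σ, fun y w => ?_, hσK, ?_⟩
  · rw [hbσ, hbσ, τ.injective.eq_iff]
  · refine hL.2 ?_ hz (by rw [hbσ, hτx])
    rw [← hσK]
    exact Finset.mem_coe.2 (Finset.smul_mem_smul_finset hx)

end SeparatedSets

/-! ### Cross intersecting pairs and their shifts -/

section CrossPairs

variable {α ι : Type*} [DecidableEq α]

/-- `A` and `B` are non-empty families of separated sets, of sizes `s` and `s'` respectively, that
are cross `t`-intersecting. -/
structure IsCrossPair (b : α → ι) (t s s' : ℕ) (A B : Finset (Finset α)) : Prop where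
  left_nonempty : A.Nonempty
  right_nonempty : B.Nonempty
  left_sep : ∀ H ∈ A, IsSeparated b s H
  right_sep : ∀ H ∈ B, IsSeparated b s' H
  cross : ∀ H ∈ A, ∀ J ∈ B, t ≤ (H ∩ J).card

variable {b : α → ι} {t s s' : ℕ} {A B A' B' : Finset (Finset α)}

lemma IsCrossPair.symm (h : IsCrossPair b t s s' A B) : IsCrossPair b t s' s B A :=
  ⟨h.2, h.1, h.4, h.3, fun H hH J hJ => by rw [Finset.inter_comm]; exact h.5 J hJ H hH⟩

lemma IsCrossPair.smul {σ : Equiv.Perm α} (hσ : PreservesFibres b σ)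
    (h : IsCrossPair b t s s' A B) : IsCrossPair b t s s' (σ • A) (σ • B) := by
  refine ⟨h.1.smul_finset, h.2.smul_finset, ?_, ?_, ?_⟩
  · intro H hH
    obtain ⟨L, hL, rfl⟩ := Finset.mem_smul_finset.1 hH
    exact (h.3 L hL).smul hσ
  · intro H hH
    obtain ⟨L, hL, rfl⟩ := Finset.mem_smul_finset.1 hH
    exact (h.4 L hL).smul hσ
  · intro H hH J hJ
    obtain ⟨L, hL, rfl⟩ := Finset.mem_smul_finset.1 hH
    obtain ⟨M, hM, rfl⟩ := Finset.mem_smul_finset.1 hJ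
    rw [← Finset.smul_finset_inter, Finset.card_smul_finset]
    exact h.5 L hL M hM

/-- For singletons, the compression of a set replaces `x` by `y` if `x` is in the set and `y` is
not. -/
lemma compress_singleton (x y : α) (H : Finset α) :
    UV.compress {y} {x} H = if x ∈ H ∧ y ∉ H then Equiv.swap x y • H else H := by
  unfold UV.compress
  simp only [Finset.disjoint_singleton_left, Finset.singleton_subset_iff]
  by_cases h : x ∈ H ∧ y ∉ H
  · rw [if_pos h, if_pos h.symm, swap_smul_of_mem_of_notMem h.1 h.2]
    ext z
    have : y ≠ x := fun e => h.2 (e ▸ h.1)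
    simp only [Finset.sup_eq_union, Finset.mem_sdiff, Finset.mem_union, Finset.mem_singleton,
      Finset.mem_insert, Finset.mem_erase]
    grind
  · rw [if_neg h, if_neg (fun h' => h h'.symm)]

/-- A member of the shifted family is either an old member whose shift is also an old member, or
the shift of an old member that has moved. -/
lemma mem_compression_singleton {x y : α} {H : Finset α} :
    H ∈ UV.compression {y} {x} A ↔
      (H ∈ A ∧ (x ∈ H → y ∉ H → Equiv.swap x y • H ∈ A)) ∨
        (H ∉ A ∧ ∃ J ∈ A, x ∈ J ∧ y ∉ J ∧ Equiv.swap x y • J = H) := by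
  rw [UV.mem_compression]
  simp only [compress_singleton]
  constructor
  · rintro (⟨h1, h2⟩ | ⟨h1, J, hJ, h2⟩)
    · refine Or.inl ⟨h1, fun h3 h4 => ?_⟩
      rwa [if_pos ⟨h3, h4⟩] at h2
    · split_ifs at h2 with h3
      · exact Or.inr ⟨h1, J, hJ, h3.1, h3.2, h2⟩
      · exact absurd (h2 ▸ hJ) h1
  · rintro (⟨h1, h2⟩ | ⟨h1, J, hJ, h3, h4, h5⟩)
    · refine Or.inl ⟨h1, ?_⟩
      split_ifs with h3
      · exact h2 h3.1 h3.2
      · exact h1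
    · exact Or.inr ⟨h1, J, hJ, by rw [if_pos ⟨h3, h4⟩, h5]⟩

lemma card_swap_smul_inter (x y : α) (H J : Finset α) :
    (Equiv.swap x y • H ∩ J).card = (H ∩ Equiv.swap x y • J).card := by
  rw [← Finset.card_smul_finset (Equiv.swap x y) (H ∩ _), Finset.smul_finset_inter, smul_smul,
    Equiv.swap_mul_self, one_smul]

lemma card_inter_le_card_swap_smul_inter {x y : α} {H J : Finset α} (hx : x ∈ H) (hy : y ∉ H)
    (hJ : x ∈ J → y ∈ J) : (H ∩ J).card ≤ (Equiv.swap x y • H ∩ J).card := by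
  rw [swap_smul_of_mem_of_notMem hx hy]
  by_cases hxJ : x ∈ J
  · have : insert y (H.erase x) ∩ J = insert y ((H ∩ J).erase x) := by
      ext z
      have := hJ hxJ
      simp only [Finset.mem_inter, Finset.mem_insert, Finset.mem_erase]
      grind
    rw [this, Finset.card_insert_of_notMem (by simp [hy]),
      Finset.card_erase_add_one (Finset.mem_inter.2 ⟨hx, hxJ⟩)]
  · refine Finset.card_le_card fun z hz => ?_
    rw [Finset.mem_inter] at hz ⊢
    exact ⟨Finset.mem_insert_of_mem (Finset.mem_erase.2 ⟨fun e => hxJ (e ▸ hz.2), hz.1⟩), hz.2⟩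

/-- Shifting both families of a cross `t`-intersecting pair within a fibre gives such a pair. -/
lemma IsCrossPair.compression {x y : α} (hxy : b x = b y) (h : IsCrossPair b t s s' A B) :
    IsCrossPair b t s s' (UV.compression {y} {x} A) (UV.compression {y} {x} B) := by
  have hsep : ∀ {r : ℕ} {C : Finset (Finset α)}, (∀ H ∈ C, IsSeparated b r H) →
      ∀ H ∈ UV.compression {y} {x} C, IsSeparated b r H := by
    intro r C hC H hH
    rcases mem_compression_singleton.1 hH with ⟨h1, -⟩ | ⟨-, J, hJ, -, -, rfl⟩
    · exact hC H h1
    · exact (hC J hJ).smul (preservesFibres_swap hxy)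
  -- a moved set against a set that stays
  have hmix : ∀ {C D : Finset (Finset α)}, (∀ H ∈ C, ∀ J ∈ D, t ≤ (H ∩ J).card) →
      ∀ H ∈ C, x ∈ H → y ∉ H → ∀ J ∈ D, (x ∈ J → y ∉ J → Equiv.swap x y • J ∈ D) →
      t ≤ (Equiv.swap x y • H ∩ J).card := by
    intro C D hCD H hH hx hy J hJ hmove
    by_cases hJ' : x ∈ J ∧ y ∉ J
    · rw [card_swap_smul_inter]
      exact hCD H hH _ (hmove hJ'.1 hJ'.2)
    · exact (hCD H hH J hJ).trans (card_inter_le_card_swap_smul_inter hx hy (by tauto))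
  have hne : ∀ {C : Finset (Finset α)}, C.Nonempty → (UV.compression {y} {x} C).Nonempty := by
    intro C hC
    rwa [← Finset.card_pos, UV.card_compression, Finset.card_pos]
  refine ⟨hne h.1, hne h.2, hsep h.3, hsep h.4, fun H hH J hJ => ?_⟩
  rcases mem_compression_singleton.1 hH with ⟨h1, h2⟩ | ⟨-, L, hL, hx, hy, rfl⟩ <;>
  rcases mem_compression_singleton.1 hJ with ⟨h3, h4⟩ | ⟨-, M, hM, hx', hy', rfl⟩
  · exact h.5 H h1 J h3
  · rw [Finset.inter_comm]
    exact hmix h.symm.5 M hM hx' hy' H h1 h2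
  · exact hmix h.5 L hL hx hy J h3 h4
  · rw [← Finset.smul_finset_inter, Finset.card_smul_finset]
    exact h.5 L hL M hM

/-! ### Extremal pairs with a smallest family -/

/-- A cross `t`-intersecting pair `(A, B)` with `|A| ≤ |B|` that maximizes `|A| + |B|` and whose
first family is as small as possible among the pairs that attain the maximum. -/
structure IsAtomPair (b : α → ι) (t s s' : ℕ) (A B : Finset (Finset α)) : Prop where
  pair : IsCrossPair b t s s' A B
  le : A.card ≤ B.card
  max : ∀ A' B', IsCrossPair b t s s' A' B' → A'.card + B'.card ≤ A.card + B.card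
  min : ∀ A' B', IsCrossPair b t s s' A' B' → A'.card + B'.card = A.card + B.card →
    A.card ≤ A'.card

/-- The uncrossing lemma: the first family of a pair of the same sizes either is disjoint from `A`
or equals `A`. -/
lemma IsAtomPair.eq_of_inter_nonempty (h : IsAtomPair b t s s' A B)
    (h' : IsCrossPair b t s s' A' B') (hA : A'.card = A.card) (hB : B'.card = B.card)
    (hne : (A ∩ A').Nonempty) : A' = A := by
  have e1 := Finset.card_union_add_card_inter A A'
  have e2 := Finset.card_union_add_card_inter B B'
  have hpos := hne.card_pos
  have p1 : IsCrossPair b t s s' (A ∩ A') (B ∪ B') := by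
    refine ⟨hne, h.pair.2.mono Finset.subset_union_left,
      fun H hH => h.pair.3 H (Finset.mem_inter.1 hH).1, fun J hJ => ?_, fun H hH J hJ => ?_⟩
    · exact (Finset.mem_union.1 hJ).elim (h.pair.4 J) (h'.4 J)
    · rw [Finset.mem_inter] at hH
      exact (Finset.mem_union.1 hJ).elim (h.pair.5 H hH.1 J) (h'.5 H hH.2 J)
  have m1 := h.max _ _ p1
  have hle := h.le
  -- otherwise `|A ∩ A'| + 2 |B| ≤ |A| + |B|`, against `|A| ≤ |B|`
  have hne' : (B ∩ B').Nonempty := by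
    rw [← Finset.card_pos]
    omega
  have p2 : IsCrossPair b t s s' (A ∪ A') (B ∩ B') := by
    refine ⟨h.pair.1.mono Finset.subset_union_left, hne', fun H hH => ?_,
      fun J hJ => h.pair.4 J (Finset.mem_inter.1 hJ).1, fun H hH J hJ => ?_⟩
    · exact (Finset.mem_union.1 hH).elim (h.pair.3 H) (h'.3 H)
    · rw [Finset.mem_inter] at hJ
      exact (Finset.mem_union.1 hH).elim (fun hH => h.pair.5 H hH J hJ.1)
        (fun hH => h'.5 H hH J hJ.2)
  have m2 := h.max _ _ p2
  have m3 := h.min _ _ p1 (by omega)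
  have e3 : A ∩ A' = A := Finset.eq_of_subset_of_card_le Finset.inter_subset_left m3
  exact (Finset.eq_of_subset_of_card_le (Finset.inter_eq_left.1 e3) hA.le).symm

/-- `A` is a block of imprimitivity for the fibre-preserving permutations. -/
lemma IsAtomPair.smul_mem (h : IsAtomPair b t s s' A B) {σ : Equiv.Perm α}
    (hσ : PreservesFibres b σ) {H J : Finset α} (hH : H ∈ A) (hσH : σ • H ∈ A) (hJ : J ∈ A) :
    σ • J ∈ A := by
  have : σ • A = A := h.eq_of_inter_nonempty (h.pair.smul hσ) (Finset.card_smul_finset _ _)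
    (Finset.card_smul_finset _ _)
    ⟨σ • H, Finset.mem_inter.2 ⟨hσH, Finset.smul_mem_smul_finset hH⟩⟩
  rw [← this]
  exact Finset.smul_mem_smul_finset hJ

/-- If some member of `A` avoids `x`, then it survives the shift from `x` to `y`; hence `A` is
stable under this shift. -/
lemma IsAtomPair.swap_smul_mem (h : IsAtomPair b t s s' A B) {x y : α} (hxy : b x = b y)
    {H J : Finset α} (hH : H ∈ A) (hxH : x ∉ H) (hJ : J ∈ A) (hxJ : x ∈ J) (hyJ : y ∉ J) :
    Equiv.swap x y • J ∈ A := by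
  have : UV.compression {y} {x} A = A :=
    h.eq_of_inter_nonempty (h.pair.compression hxy) (UV.card_compression _ _ _)
      (UV.card_compression _ _ _)
      ⟨H, Finset.mem_inter.2
        ⟨hH, mem_compression_singleton.2 (Or.inl ⟨hH, fun hx => absurd hx hxH⟩)⟩⟩
  rw [← this] at hJ
  rcases mem_compression_singleton.1 hJ with ⟨-, h2⟩ | ⟨h1, -⟩
  · exact h2 hxJ hyJ
  · exact absurd (this ▸ hJ) h1

/-- The smaller family of an atom pair is a singleton. -/
lemma IsAtomPair.card_eq_one [Fintype α] [Fintype ι] [DecidableEq ι] {n : ℕ} (hn : 2 ≤ n)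
    (hb : ∀ i, Fintype.card {x // b x = i} = n) (ht : 1 ≤ t) (h : IsAtomPair b t s s' A B) :
    A.card = 1 := by
  have hother : ∀ x, ∃ y, y ≠ x ∧ b x = b y := by
    intro x
    have : 1 < Fintype.card {y // b y = b x} := by rw [hb]; omega
    obtain ⟨y, hy⟩ := Fintype.exists_ne_of_one_lt_card this ⟨x, rfl⟩
    exact ⟨y, fun e => hy (Subtype.ext e), y.2.symm⟩
  by_contra hA
  have hA1 : 1 < A.card := by
    have := h.pair.1.card_pos
    omega
  obtain ⟨H, hH, K, hK, hne⟩ := Finset.one_lt_card.1 hA1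
  obtain ⟨x, hxK, hxH⟩ : ∃ x ∈ K, x ∉ H := by
    by_contra! hc
    exact hne (Finset.eq_of_subset_of_card_le hc
      (by rw [(h.pair.3 H hH).1, (h.pair.3 K hK).1])).symm
  obtain ⟨y, hyx, hxy⟩ := hother x
  have hyK := (h.pair.3 K hK).notMem_of_mem hxK hyx hxy
  have hK' := h.swap_smul_mem hxy hH hxH hK hxK hyK
  -- `A` is closed under replacing an element by another one of the same fibre
  have hclosed : ∀ L ∈ A, ∀ z ∈ L, ∀ w, w ≠ z → b z = b w → insert w (L.erase z) ∈ A := by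
    intro L hL z hz w hwz hzw
    have hLs := h.pair.3 L hL
    obtain ⟨σ, hσ, hσK, hσx⟩ := exists_preservesFibres_smul_eq hb (h.pair.3 K hK) hLs hxK hz
    have hσy : b (σ y) = b z := by rw [← hσx]; exact (hσ y x).2 hxy.symm
    have hσyz : σ y ≠ z := by rw [← hσx]; exact fun e => hyx (σ.injective e)
    have hσyL := hLs.notMem_of_mem hz hσyz hσy.symm
    have hwL := hLs.notMem_of_mem hz hwz hzw
    -- `ρ` carries `K` to `L`, `x` to `z` and `y` to `w`
    let ρ := Equiv.swap (σ y) w * σ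
    have hρ : PreservesFibres b ρ := (preservesFibres_swap (hσy.trans hzw)).mul hσ
    have hρK : ρ • K = L := by
      rw [mul_smul, hσK, swap_smul_of_notMem hσyL hwL]
    have hρx : ρ x = z := by
      change Equiv.swap (σ y) w (σ x) = z
      rw [hσx, Equiv.swap_apply_of_ne_of_ne hσyz.symm hwz.symm]
    have hρy : ρ y = w := by
      change Equiv.swap (σ y) w (σ y) = w
      rw [Equiv.swap_apply_left]
    have := h.smul_mem hρ hK (by rwa [hρK]) hK'
    rwa [swap_smul_of_mem_of_notMem hxK hyK, Finset.smul_finset_insert, Finset.erase_eq,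
      Finset.smul_finset_sdiff, hρK, Finset.smul_finset_singleton, Equiv.Perm.smul_def,
      Equiv.Perm.smul_def, hρx, hρy, ← Finset.erase_eq] at this
  -- a member of `A` that meets `G` least must be disjoint from `G`
  obtain ⟨G, hG⟩ := h.pair.2
  obtain ⟨L, hL, hmin⟩ := A.exists_min_image (fun L => (L ∩ G).card) h.pair.1
  obtain ⟨z, hz⟩ := Finset.card_pos.1 (ht.trans (h.pair.5 L hL G hG))
  rw [Finset.mem_inter] at hz
  obtain ⟨w, hwz, hzw⟩ := hother z
  have hwG := (h.pair.4 G hG).notMem_of_mem hz.2 hwz hzw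
  have hlt := hmin _ (hclosed L hL z hz.1 w hwz hzw)
  rw [Finset.insert_inter_of_notMem hwG, Finset.erase_inter] at hlt
  exact absurd hlt (not_le.2 (Finset.card_erase_lt_of_mem (Finset.mem_inter.2 hz)))

lemma IsCrossPair.exists_isAtomPair [Fintype α] (h : IsCrossPair b t s s' A B) :
    ∃ A₀ B₀, A.card + B.card ≤ A₀.card + B₀.card ∧
      (IsAtomPair b t s s' A₀ B₀ ∨ IsAtomPair b t s' s B₀ A₀) := by
  classical
  let S : Finset (Finset (Finset α) × Finset (Finset α)) :=
    Finset.univ.filter fun p => IsCrossPair b t s s' p.1 p.2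
  have hS : ∀ p, p ∈ S ↔ IsCrossPair b t s s' p.1 p.2 := fun p => by simp [S]
  obtain ⟨p, hp, hmax⟩ := S.exists_max_image (fun p => p.1.card + p.2.card) ⟨(A, B), (hS _).2 h⟩
  obtain ⟨q, hq, hmin⟩ :=
    (S.filter fun q => q.1.card + q.2.card = p.1.card + p.2.card).exists_min_image
      (fun q => min q.1.card q.2.card) ⟨p, Finset.mem_filter.2 ⟨hp, rfl⟩⟩
  rw [Finset.mem_filter, hS] at hq
  refine ⟨q.1, q.2, hq.2 ▸ hmax (A, B) ((hS _).2 h), ?_⟩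
  have hmax' : ∀ A' B', IsCrossPair b t s s' A' B' →
      A'.card + B'.card ≤ q.1.card + q.2.card := fun A' B' h' =>
    hq.2 ▸ hmax (A', B') ((hS _).2 h')
  have hmin' : ∀ A' B', IsCrossPair b t s s' A' B' → A'.card + B'.card = q.1.card + q.2.card →
      min q.1.card q.2.card ≤ min A'.card B'.card := fun A' B' h' he =>
    hmin (A', B') (Finset.mem_filter.2 ⟨(hS _).2 h', he.trans hq.2⟩)
  rcases le_total q.1.card q.2.card with hle | hle
  · refine Or.inl ⟨hq.1, hle, hmax', fun A' B' h' he => ?_⟩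
    have := hmin' A' B' h' he
    omega
  · refine Or.inr ⟨hq.1.symm, hle, fun A' B' h' => ?_, fun A' B' h' he => ?_⟩
    · have := hmax' B' A' h'.symm
      omega
    · have := hmin' B' A' h'.symm (by omega)
      omega

/-- The sum of the sizes is at most that of a pair one of whose families is a singleton. -/
lemma IsCrossPair.exists_card_add_card_le [Fintype α] [Fintype ι] [DecidableEq ι] {n : ℕ}
    (hn : 2 ≤ n) (hb : ∀ i, Fintype.card {x // b x = i} = n) (ht : 1 ≤ t)
    (h : IsCrossPair b t s s' A B) :
    (∃ (K : Finset α) (C : Finset (Finset α)), IsCrossPair b t s s' {K} C ∧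
      A.card + B.card ≤ C.card + 1) ∨
    (∃ (K : Finset α) (C : Finset (Finset α)), IsCrossPair b t s s' C {K} ∧
      A.card + B.card ≤ C.card + 1) := by
  obtain ⟨A₀, B₀, hle, h₀ | h₀⟩ := h.exists_isAtomPair
  · have hc := h₀.card_eq_one hn hb ht
    obtain ⟨K, rfl⟩ := Finset.card_eq_one.1 hc
    exact Or.inl ⟨K, B₀, h₀.pair, by omega⟩
  · have hc := h₀.card_eq_one hn hb ht
    obtain ⟨K, rfl⟩ := Finset.card_eq_one.1 hc
    exact Or.inr ⟨K, A₀, h₀.pair.symm, by omega⟩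

end CrossPairs

/-! ### The families for the given blocks -/

lemma mem_sepH_iff {m k s : ℕ} {X : Fin k → Finset (Fin m)} {b : Fin m → Fin k}
    (hb : ∀ x i, x ∈ X i ↔ b x = i) {H : Finset (Fin m)} :
    H ∈ sepH X s ↔ IsSeparated b s H := by
  simp only [sepH, Finset.mem_filter, Finset.mem_powersetCard, Finset.subset_univ, true_and,
    IsSeparated, Finset.card_le_one, Finset.mem_inter, hb]
  refine and_congr_right fun _ => ⟨fun h x hx y hy hxy => h _ x ⟨hx, hxy⟩ y ⟨hy, rfl⟩, ?_⟩
  intro h i x hx y hy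
  exact h hx.1 hy.1 (hx.2.trans hy.2.symm)

/-- By transitivity, the number of sets meeting `K` in at least `t` elements depends only on the
size of `K`, so that `K` may be replaced by `{v_1, …, v_a}`. -/
lemma card_le_card_atLeastT {m n k s s' t a : ℕ} {X : Fin k → Finset (Fin m)} {b : Fin m → Fin k}
    (hb : ∀ x i, x ∈ X i ↔ b x = i) (hn : ∀ i, Fintype.card {x // b x = i} = n)
    {v : Fin k → Fin m} (hV : IsSeparated b s (firstV v a)) (ht : 1 ≤ t)
    {K : Finset (Fin m)} {C : Finset (Finset (Fin m))} (h : IsCrossPair b t s s' {K} C) :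
    C.card ≤ (atLeastT X v s' t a).card := by
  have hK := h.left_sep K (Finset.mem_singleton_self K)
  have hcross := h.cross K (Finset.mem_singleton_self K)
  obtain ⟨G, hG⟩ := h.right_nonempty
  obtain ⟨x, hx⟩ := Finset.card_pos.1 (ht.trans (hcross G hG))
  have hxK := (Finset.mem_inter.1 hx).1
  obtain ⟨z, hz⟩ : (firstV v a).Nonempty := by
    rw [← Finset.card_pos, hV.1, ← hK.1]
    exact Finset.card_pos.2 ⟨x, hxK⟩
  obtain ⟨σ, hσ, hσK, -⟩ := exists_preservesFibres_smul_eq hn hK hV hxK hz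
  rw [← Finset.card_smul_finset σ C]
  refine Finset.card_le_card fun J hJ => ?_
  obtain ⟨L, hL, rfl⟩ := Finset.mem_smul_finset.1 hJ
  refine Finset.mem_filter.2 ⟨(mem_sepH_iff hb).2 ((h.right_sep L hL).smul hσ), ?_⟩
  rw [← hσK, ← Finset.smul_finset_inter, Finset.card_smul_finset, Finset.inter_comm]
  exact hcross L hL

theorem theorem1p6 {m n k ℓ ℓ' t : ℕ}
    (hn : 2 ≤ n) (hkℓ : ℓ ≤ k) (hℓ : ℓ' ≤ ℓ) (htℓ : t ≤ ℓ') (ht : 1 ≤ t)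
    (X : Fin k → Finset (Fin m))
    (hdisj : ∀ i j, i ≠ j → Disjoint (X i) (X j))
    (hcover : ∀ x : Fin m, ∃ i, x ∈ X i)
    (hcard : ∀ i, (X i).card = n)
    (v : Fin k → Fin m)
    (hv : ∀ i, IsLeast (X i : Set (Fin m)) (v i))
    (F G : Finset (Finset (Fin m)))
    (hF : F ⊆ sepH X ℓ) (hG : G ⊆ sepH X ℓ')
    (hF0 : F.Nonempty) (hG0 : G.Nonempty)
    (hFG : CrossTIntersecting t F G) :
    F.card + G.card ≤
      max ((famF0 X v ℓ ℓ' t).card + (famG0 v ℓ').card)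
        ((Finset.Icc (ℓ' + 1) ℓ).sup
          (fun a => (famF X v ℓ a).card + (famG X v ℓ' t a).card)) := by
  choose b hbX using hcover
  have hb : ∀ x i, x ∈ X i ↔ b x = i := by
    refine fun x i => ⟨fun hx => ?_, fun hx => hx ▸ hbX x⟩
    by_contra hne
    exact Finset.disjoint_left.1 (hdisj _ _ hne) (hbX x) hx
  have hfib : ∀ i, Fintype.card {x // b x = i} = n := by
    intro i
    rw [← hcard i, Fintype.card_subtype]
    congr 1
    ext x
    simp [hb]
  have hbv : ∀ i, b (v i) = i := fun i => (hb _ _).1 (hv i).1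
  have hV : ∀ a ≤ k, IsSeparated b a (firstV v a) := by
    intro a ha
    constructor
    · rw [firstV, Finset.card_image_of_injective _ (Function.LeftInverse.injective hbv),
        Fin.card_filter_val_lt, min_eq_right ha]
    · intro x hx y hy hxy
      obtain ⟨i, -, rfl⟩ := Finset.mem_image.1 hx
      obtain ⟨j, -, rfl⟩ := Finset.mem_image.1 hy
      rw [hbv, hbv] at hxy
      rw [hxy]
  have hpair : IsCrossPair b t ℓ ℓ' F G :=
    ⟨hF0, hG0, fun H hH => (mem_sepH_iff hb).1 (hF hH), fun H hH => (mem_sepH_iff hb).1 (hG hH),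
      hFG⟩
  have hG01 : (famG0 v ℓ').card = 1 := Finset.card_singleton _
  obtain ⟨K, C, hC, hle⟩ | ⟨K, C, hC, hle⟩ := hpair.exists_card_add_card_le hn hfib ht
  -- the singleton is on the side of `F`: this is the term `a = ℓ`, unless `ℓ = ℓ'`, where `a = ℓ` is
  -- outside the range and the roles of the two families can be exchanged
  · have hC' := card_le_card_atLeastT hb hfib (hV ℓ hkℓ) ht hC
    rcases hℓ.eq_or_lt with rfl | hlt
    · refine le_max_of_le_left ?_
      rw [hG01, famF0]
      omega
    · refine le_max_of_le_right (le_trans ?_ (Finset.le_sup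
        (f := fun a => (famF X v ℓ a).card + (famG X v ℓ' t a).card)
        (Finset.mem_Icc.2 ⟨hlt, le_refl ℓ⟩)))
      have hpos : 0 < (famF X v ℓ ℓ).card := Finset.card_pos.2
        ⟨firstV v ℓ, Finset.mem_filter.2 ⟨(mem_sepH_iff hb).2 (hV ℓ hkℓ), subset_rfl⟩⟩
      change _ ≤ (famF X v ℓ ℓ).card + (atLeastT X v ℓ' t ℓ).card
      omega
  · have hC' := card_le_card_atLeastT hb hfib (hV ℓ' (hℓ.trans hkℓ)) ht hC.symm
    refine le_max_of_le_left ?_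
    rw [hG01, famF0]
    omega
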